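/- Let $n\ge 2$, let $d_1,\dots,d_n\ge 2$ be integers, let $\mathcal H$ be a complex Hilbert space of dimension $\prod_{i=1}^n d_i$, and let $\mathcal H_1,\dots,\mathcal H_n$ be complex Hilbert spaces with $\dim\mathcal H_i=d_i$. A tensor product structure (TPS) of $\mathcal H$ is an equivalence class $\mathcal T=[T]$ of unitary isomorphisms $T:\mathcal H\to\bigotimes_{i=1}^n\mathcal H_i$, where $T_1\sim T_2$ means that $T_1T_2^{-1}$ is the composition of a product of local unitaries $U_1\otimes\dots\otimes U_n$ with a permutation of the factors (of equal dimension). For a unitary $U$ on $\mathcal H$ put $U\cdot[T]=[TU]$, and call $U$ a symmetry of $\mathcal T$ if $U\cdot\mathcal T=\mathcal T$. For each $i$ let $(O_i^\alpha)_{0\le\alpha\le d_i^2-1}$ denote a basis of $\mathcal L(\mathcal H_i)$ with $O_i^0=\mathbb 1$ that is orthonormal for the normalised Hilbert–Schmidt inner product $\langle A,B\rangle=\frac1{d_i}\operatorname{tr}(A^\dagger B)$. A Hermitian operator $\hat H$ on $\mathcal H$ is $1$-local with respect to $\mathcal T=[T]$ if for some choice of such bases the expansion $$T\hat HT^{-1}=\sum_{\alpha_1,\dots,\alpha_n}a_{\alpha_1\dots\alpha_n}\,O_1^{\alpha_1}\otimes\dots\otimes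 O_n^{\alpha_n}$$ has $a_{\alpha_1\dots\alpha_n}=0$ whenever more than one of the $\alpha_i$ is nonzero. (This does not depend on the representative $T$.) **Proposition.** Let $\mathcal T$ be a TPS of $\mathcal H$ and $\hat H$ a Hermitian operator on $\mathcal H$. The unitaries $e^{-it\hat H}$, $t\in\mathbb R$, are all symmetries of $\mathcal T$ if and only if $\hat H$ is $1$-local with respect to $\mathcal T$. -/

import Mathlib

open scoped TensorProduct

noncomputable section

namespace TPSLocality

section Structure

variable {n : ℕ}
  (H : Type*) [NormedAddCommGroup H] [InnerProductSpace ℂ H]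
  (F : Fin n → Type*) [∀ i, NormedAddCommGroup (F i)] [∀ i, InnerProductSpace ℂ (F i)]

/-- A Hilbert space isomorphism `T : H → F 1 ⊗ ⋯ ⊗ F n`: a linear bijection which is unitary for
the tensor product inner product, i.e. the one with `⟪⨂ xᵢ, ⨂ yᵢ⟫ = ∏ ⟪xᵢ, yᵢ⟫`.  As the pure
tensors span, unitarity is the stated condition on pure tensors. -/
structure TensorIso where
  toLinearEquiv : H ≃ₗ[ℂ] ⨂[ℂ] i, F i
  inner_symm_tprod : ∀ x y : ∀ i, F i,
    inner ℂ (toLinearEquiv.symm (PiTensorProduct.tprod ℂ x))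
      (toLinearEquiv.symm (PiTensorProduct.tprod ℂ y)) = ∏ i, inner ℂ (x i) (y i)

variable {F}

/-- `W` is a product of local unitaries and a permutation of the factors: the factor `σ⁻¹ i` is
moved to position `i` and is mapped there unitarily onto `F i`.
(So `σ` can only permute factors of equal dimension.) -/
def IsLocalPerm (W : (⨂[ℂ] i, F i) ≃ₗ[ℂ] ⨂[ℂ] i, F i) : Prop :=
  ∃ (σ : Equiv.Perm (Fin n)) (V : ∀ i, F (σ.symm i) ≃ₗᵢ[ℂ] F i), ∀ x : ∀ i, F i,
    W (PiTensorProduct.tprod ℂ x) = PiTensorProduct.tprod ℂ fun i => V i (x (σ.symm i))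

theorem IsLocalPerm.refl : IsLocalPerm (LinearEquiv.refl ℂ (⨂[ℂ] i, F i)) :=
  ⟨1, fun i => LinearIsometryEquiv.refl ℂ (F i), fun _ => rfl⟩

theorem IsLocalPerm.trans {W W' : (⨂[ℂ] i, F i) ≃ₗ[ℂ] ⨂[ℂ] i, F i}
    (h : IsLocalPerm W) (h' : IsLocalPerm W') : IsLocalPerm (W.trans W') := by
  obtain ⟨σ, V, hV⟩ := h
  obtain ⟨τ, V', hV'⟩ := h'
  refine ⟨σ.trans τ, fun i => (V (τ.symm i)).trans (V' i), fun x => ?_⟩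
  rw [LinearEquiv.trans_apply, hV, hV']
  rfl

theorem IsLocalPerm.symm {W : (⨂[ℂ] i, F i) ≃ₗ[ℂ] ⨂[ℂ] i, F i}
    (h : IsLocalPerm W) : IsLocalPerm W.symm := by
  obtain ⟨σ, V, hV⟩ := h
  have key : ∀ i, ∃ V' : F (σ i) ≃ₗᵢ[ℂ] F i, ∀ x : ∀ j, F j,
      V' (V (σ i) (x (σ.symm (σ i)))) = x i := by
    intro i
    have aux : ∀ j k (e : k = j) (L : F k ≃ₗᵢ[ℂ] F (σ i)),
        ∃ V' : F (σ i) ≃ₗᵢ[ℂ] F j, ∀ x : ∀ j, F j, V' (L (x k)) = x j := by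
      rintro j k rfl L
      exact ⟨L.symm, fun x => by simp⟩
    exact aux i _ (σ.symm_apply_apply i) (V (σ i))
  choose V' hV' using key
  refine ⟨σ.symm, V', fun y => ?_⟩
  rw [LinearEquiv.symm_apply_eq, hV]
  congr 1
  funext i
  have hy := hV' (σ.symm i)
  have aux : ∀ k (e : k = i) (L' : F k ≃ₗᵢ[ℂ] F (σ.symm i)),
      (∀ x : ∀ j, F j, L' (V k (x (σ.symm k))) = x (σ.symm i)) →
        y i = V i (L' (y k)) := by
    rintro k rfl L' hL
    obtain ⟨x, hx⟩ : ∃ x : ∀ j, F j, x (σ.symm k) = (V k).symm (y k) :=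
      ⟨Function.update 0 _ ((V k).symm (y k)), by simp⟩
    have := hL x
    rw [hx] at this
    simp only [LinearIsometryEquiv.apply_symm_apply] at this
    simp [this]
  exact aux _ (σ.apply_symm_apply i) _ hy

variable (F)

/-- `T₁ ∼ T₂` iff `T₁ T₂⁻¹` is a product of local unitaries and a permutation of the factors. -/
instance tensorIsoSetoid : Setoid (TensorIso H F) where
  r T₁ T₂ := IsLocalPerm (T₂.toLinearEquiv.symm.trans T₁.toLinearEquiv)
  iseqv :=
    { refl := fun T => by
        rw [LinearEquiv.symm_trans_self]
        exact IsLocalPerm.refl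
      symm := fun h => h.symm
      trans := fun {T₁ T₂ T₃} h h' => by
        have e : T₃.toLinearEquiv.symm.trans T₁.toLinearEquiv =
            (T₃.toLinearEquiv.symm.trans T₂.toLinearEquiv).trans
              (T₂.toLinearEquiv.symm.trans T₁.toLinearEquiv) := by
          ext x
          simp
        rw [e]
        exact h'.trans h }

/-- A tensor product structure (TPS) of `H` into the factors `F i`. -/
def TPS := Quotient (tensorIsoSetoid H F)

end Structure

section Action

variable {n : ℕ}
  {H : Type*} [NormedAddCommGroup H] [InnerProductSpace ℂ H] [CompleteSpace H]
  {F : Fin n → Type*} [∀ i, NormedAddCommGroup (F i)] [∀ i, InnerProductSpace ℂ (F i)]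

/-- The isomorphism `T U`, for `U` a unitary operator on `H`. -/
def TensorIso.precomp (T : TensorIso H F) (U : unitary (H →L[ℂ] H)) : TensorIso H F where
  toLinearEquiv := (Unitary.linearIsometryEquiv U).toLinearEquiv.trans T.toLinearEquiv
  inner_symm_tprod x y := by
    rw [← T.inner_symm_tprod x y]
    exact (Unitary.linearIsometryEquiv U).symm.inner_map_map _ _

/-- `U · [T] = [T U]`. -/
def TPS.act (U : unitary (H →L[ℂ] H)) : TPS H F → TPS H F :=
  Quotient.map (fun T => T.precomp U) fun T₁ T₂ h => by
    have e : (T₂.precomp U).toLinearEquiv.symm.trans (T₁.precomp U).toLinearEquiv =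
        T₂.toLinearEquiv.symm.trans T₁.toLinearEquiv := by
      refine LinearEquiv.ext fun x => ?_
      exact congrArg T₁.toLinearEquiv
        ((Unitary.linearIsometryEquiv U).apply_symm_apply (T₂.toLinearEquiv.symm x))
    change IsLocalPerm _
    rw [e]
    exact h

/-- The symmetries of a TPS: the unitaries `U` with `U · 𝒯 = 𝒯`. -/
def TPS.stab (𝒯 : TPS H F) : Set (unitary (H →L[ℂ] H)) := {U | TPS.act U 𝒯 = 𝒯}

/-- The time evolution unitary `exp (-i t Ĥ)` of a Hamiltonian `Ĥ`. -/
def timeEvolution (Ĥ : selfAdjoint (H →L[ℂ] H)) (t : ℝ) : unitary (H →L[ℂ] H) :=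
  ⟨NormedSpace.exp ((-(Complex.I * (t : ℂ))) • (Ĥ : H →L[ℂ] H)), by
    have e : (-(Complex.I * (t : ℂ))) • (Ĥ : H →L[ℂ] H) =
        Complex.I • (((-t) • Ĥ : selfAdjoint (H →L[ℂ] H)) : H →L[ℂ] H) := by
      rw [selfAdjoint.val_smul, ← Complex.coe_smul, smul_smul]
      congr 1
      push_cast
      ring
    rw [e]
    exact (selfAdjoint.expUnitary ((-t) • Ĥ)).2⟩

/-- `(O_α)` is a basis of `L(E)`, `0 ≤ α < d²`, `d = dim E`, with `O_0 = 1`, orthonormal for the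
Hilbert-Schmidt inner product, normalised (so that the identity is a unit vector) as
`⟨A, B⟩ = d⁻¹ tr(A† B)`. -/
structure IsSiteBasis {E : Type*} [NormedAddCommGroup E] [InnerProductSpace ℂ E]
    [FiniteDimensional ℂ E]
    (O : Module.Basis (Fin (Module.finrank ℂ E ^ 2)) ℂ (E →ₗ[ℂ] E)) : Prop where
  zero : ∀ α : Fin (Module.finrank ℂ E ^ 2), (α : ℕ) = 0 → O α = LinearMap.id
  orthonormal : ∀ α β, (Module.finrank ℂ E : ℂ)⁻¹ *
    LinearMap.trace ℂ E (LinearMap.adjoint (O α) ∘ₗ O β) = if α = β then 1 else 0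

/-- `Ĥ` is `K`-local with respect to `𝒯`: for some representative `T` of `𝒯` and some site bases
`(O_i^α)`, the coefficients `a_α`, `α = (α_1, …, α_n)`, of the decomposition of `T Ĥ T⁻¹` in the
product basis `O_1^{α_1} ⊗ ⋯ ⊗ O_n^{α_n}` vanish whenever more than `K` of the `α_i` are nonzero. -/
def IsKLocal [∀ i, FiniteDimensional ℂ (F i)] (K : ℕ) (Ĥ : selfAdjoint (H →L[ℂ] H))
    (𝒯 : TPS H F) : Prop :=
  ∃ T : TensorIso H F, (Quotient.mk _ T : TPS H F) = 𝒯 ∧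
    ∃ O : ∀ i, Module.Basis (Fin (Module.finrank ℂ (F i) ^ 2)) ℂ (F i →ₗ[ℂ] F i),
      (∀ i, IsSiteBasis (O i)) ∧
      ∃ a : (∀ i, Fin (Module.finrank ℂ (F i) ^ 2)) → ℂ,
        (∀ α, K < (Finset.univ.filter fun i => (α i : ℕ) ≠ 0).card → a α = 0) ∧
        T.toLinearEquiv.conj ((Ĥ : H →L[ℂ] H) : H →ₗ[ℂ] H) =
          ∑ α, a α • PiTensorProduct.map fun i => O i (α i)

end Action

end TPSLocality

end

/-! If every `e^{-itĤ}` is a symmetry, put `N = n!`. Then `e^{-itĤ}` is the `N`-th power of a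
symmetry, and the `N`-th power of any permutation is trivial, so `e^{-itĤ}` is a product operator
for every `t` (`conj_timeEvolution_eq_map`); no continuity argument is needed. Coefficients of
product operators satisfy the quadratic Segre relations (`productBasis_repr_map_mul`).
Differentiating these at `t = 0`, where the operator is the identity, kills every coefficient of `Ĥ`
with two nontrivial sites.

Conversely, a 1-local `Ĥ` is a sum of single-site operators, which can be taken Hermitian by
averaging with adjoints. Operators on different sites commute, so the exponential factors into local
unitaries (`exp_sum_siteHom`). -/

open scoped TensorProduct

noncomputable section

namespace TPSLocality

open PiTensorProduct Module

/-! ### Product operators and their coefficients -/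

section ProductOperators

variable {ι : Type*} {E : ι → Type*} [∀ i, AddCommGroup (E i)] [∀ i, Module ℂ (E i)]

/-- The operator on `⨂ E i` acting as `A` on the factor `i` and trivially on the others. -/
def singleSite [DecidableEq ι] (i : ι) : End ℂ (E i) →ₐ[ℂ] End ℂ (⨂[ℂ] j, E j) :=
  AlgHom.ofLinearMap ((mapMultilinear ℂ E E).toLinearMap 1 i)
    (map_one ((mapMonoidHom (R := ℂ) (s := E)).comp (MonoidHom.mulSingle _ i)))
    (map_mul ((mapMonoidHom (R := ℂ) (s := E)).comp (MonoidHom.mulSingle _ i)))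

theorem singleSite_apply [DecidableEq ι] (i : ι) (A : End ℂ (E i)) :
    singleSite i A = PiTensorProduct.map (Pi.mulSingle i A : ∀ j, End ℂ (E j)) := rfl

/-- Each matrix unit of the product basis is the image of a tensor of matrix units. -/
theorem piTensorHomMap_surjective [Finite ι] [∀ i, FiniteDimensional ℂ (E i)] :
    Function.Surjective (piTensorHomMap (R := ℂ) (s := E) (t := E)) := by
  classical
  have := Fintype.ofFinite ι
  let b := fun i => finBasis ℂ (E i)
  let B := Basis.piTensorProduct b
  rw [← LinearMap.range_eq_top, eq_top_iff, ← (B.linearMap B).span_eq, Submodule.span_le]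
  rintro _ ⟨⟨p, q⟩, rfl⟩
  refine ⟨PiTensorProduct.tprod ℂ fun i => (b i).linearMap (b i) (p i, q i), B.ext fun r => ?_⟩
  rw [Basis.linearMap_apply_apply, Basis.piTensorProduct_apply, piTensorHomMap_tprod_tprod]
  simp only [Basis.linearMap_apply_apply, B]
  split_ifs with h
  · subst h; simp
  · obtain ⟨i, hi⟩ := Function.ne_iff.1 h
    exact (PiTensorProduct.tprod ℂ).map_coord_zero i (if_neg hi)

theorem piTensorHomMap_injective [Finite ι] [∀ i, FiniteDimensional ℂ (E i)] :
    Function.Injective (piTensorHomMap (R := ℂ) (s := E) (t := E)) := by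
  classical
  have := Fintype.ofFinite ι
  refine (LinearMap.injective_iff_surjective_of_finrank_eq_finrank ?_).2 piTensorHomMap_surjective
  let b := fun i => finBasis ℂ (E i)
  rw [finrank_eq_card_basis (Basis.piTensorProduct fun i => (b i).linearMap (b i)),
    finrank_linearMap, finrank_eq_card_basis (Basis.piTensorProduct b)]
  simp [Finset.prod_mul_distrib]

/-- The operators `⨂ O_i^{α_i}` form a basis of the operators on `⨂ E i`. -/
def productBasis [Finite ι] [∀ i, FiniteDimensional ℂ (E i)] {κ : ι → Type*}
    (O : ∀ i, Basis (κ i) ℂ (E i →ₗ[ℂ] E i)) :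
    Basis (∀ i, κ i) ℂ ((⨂[ℂ] i, E i) →ₗ[ℂ] ⨂[ℂ] i, E i) :=
  (Basis.piTensorProduct O).map
    (LinearEquiv.ofBijective piTensorHomMap ⟨piTensorHomMap_injective, piTensorHomMap_surjective⟩)

theorem productBasis_apply [Finite ι] [∀ i, FiniteDimensional ℂ (E i)] {κ : ι → Type*}
    (O : ∀ i, Basis (κ i) ℂ (E i →ₗ[ℂ] E i)) (α : ∀ i, κ i) :
    productBasis O α = PiTensorProduct.map fun i => O i (α i) := by
  simp only [productBasis, Basis.map_apply, Basis.piTensorProduct_apply]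
  exact piTensorHomMap_tprod_eq_map _

theorem productBasis_repr_map [Fintype ι] [∀ i, FiniteDimensional ℂ (E i)] {κ : ι → Type*}
    (O : ∀ i, Basis (κ i) ℂ (E i →ₗ[ℂ] E i)) (V : ∀ i, E i →ₗ[ℂ] E i) (α : ∀ i, κ i) :
    (productBasis O).repr (PiTensorProduct.map V) α = ∏ i, (O i).repr (V i) (α i) := by
  have h : (LinearEquiv.ofBijective piTensorHomMap
      ⟨piTensorHomMap_injective, piTensorHomMap_surjective⟩).symm (PiTensorProduct.map V) =
        PiTensorProduct.tprod ℂ V := by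
    rw [LinearEquiv.symm_apply_eq]
    exact (piTensorHomMap_tprod_eq_map V).symm
  simp [productBasis, h]

/-- The coefficients of a product operator satisfy the Segre relations. -/
theorem productBasis_repr_map_mul [Fintype ι] [DecidableEq ι] [∀ i, FiniteDimensional ℂ (E i)]
    {κ : ι → Type*} (O : ∀ i, Basis (κ i) ℂ (E i →ₗ[ℂ] E i)) (V : ∀ i, E i →ₗ[ℂ] E i)
    (α β : ∀ i, κ i) (i : ι) :
    (productBasis O).repr (PiTensorProduct.map V) α *
        (productBasis O).repr (PiTensorProduct.map V) β =
      (productBasis O).repr (PiTensorProduct.map V) (Function.update α i (β i)) *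
        (productBasis O).repr (PiTensorProduct.map V) (Function.update β i (α i)) := by
  simp only [productBasis_repr_map, ← Finset.prod_mul_distrib]
  refine Finset.prod_congr rfl fun j _ => ?_
  -- At site `i` the two coefficients trade places; at every other site nothing changes.
  rcases eq_or_ne j i with rfl | h
  · simp [mul_comm]
  · simp [h]

end ProductOperators

/-! ### Existence of site bases -/

section SiteBasis

variable (E : Type*) [NormedAddCommGroup E] [InnerProductSpace ℂ E] [FiniteDimensional ℂ E]

variable {E} in
theorem trace_adjoint_comp_self (A : E →ₗ[ℂ] E) :
    LinearMap.trace ℂ E (LinearMap.adjoint A ∘ₗ A) =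
      ((∑ i, ‖A (stdOrthonormalBasis ℂ E i)‖ ^ 2 : ℝ) : ℂ) := by
  rw [LinearMap.trace_eq_sum_inner _ (stdOrthonormalBasis ℂ E)]
  simp [LinearMap.adjoint_inner_right, inner_self_eq_norm_sq_to_K]

/-- The normalised Hilbert-Schmidt inner product `⟨A, B⟩ = d⁻¹ tr(A† B)`, `d = dim E`. -/
@[reducible]
def hilbertSchmidtCore [Nontrivial E] : InnerProductSpace.Core ℂ (E →ₗ[ℂ] E) where
  inner A B := (finrank ℂ E : ℂ)⁻¹ * LinearMap.trace ℂ E (LinearMap.adjoint A ∘ₗ B)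
  conj_inner_symm A B := by
    simp [LinearMap.trace_eq_sum_inner _ (stdOrthonormalBasis ℂ E), LinearMap.adjoint_inner_right]
  re_inner_nonneg A := by
    rw [trace_adjoint_comp_self, ← Complex.ofReal_natCast, ← Complex.ofReal_inv,
      ← Complex.ofReal_mul]
    have h : 0 ≤ (finrank ℂ E : ℝ)⁻¹ * ∑ i, ‖A (stdOrthonormalBasis ℂ E i)‖ ^ 2 := by positivity
    exact h.trans_eq (RCLike.ofReal_re (K := ℂ) _).symm
  add_left A B C := by simp [LinearMap.add_comp, mul_add]
  smul_left A B r := by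
    rw [show LinearMap.adjoint (r • A) = starRingEnd ℂ r • LinearMap.adjoint A from
      map_smulₛₗ _ _ _, LinearMap.smul_comp, map_smul, smul_eq_mul, mul_left_comm]
  definite A h := by
    have hd : (finrank ℂ E : ℂ)⁻¹ ≠ 0 := inv_ne_zero (Nat.cast_ne_zero.2 finrank_pos.ne')
    have h' := (mul_eq_zero.1 h).resolve_left hd
    rw [trace_adjoint_comp_self, Complex.ofReal_eq_zero,
      Finset.sum_eq_zero_iff_of_nonneg fun _ _ => by positivity] at h'
    refine (stdOrthonormalBasis ℂ E).toBasis.ext fun i => ?_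
    simpa using h' i (Finset.mem_univ i)

/-- With the factor `d⁻¹` the identity is a unit vector, so it extends to an orthonormal basis. -/
theorem exists_isSiteBasis [Nontrivial E] :
    ∃ O : Basis (Fin (finrank ℂ E ^ 2)) ℂ (E →ₗ[ℂ] E), IsSiteBasis O := by
  let core := hilbertSchmidtCore E
  let : NormedAddCommGroup (E →ₗ[ℂ] E) := core.toNormedAddCommGroup
  let : InnerProductSpace ℂ (E →ₗ[ℂ] E) := InnerProductSpace.ofCore core.toCore
  have hinner : ∀ A B : E →ₗ[ℂ] E, inner ℂ A B =
      (finrank ℂ E : ℂ)⁻¹ * LinearMap.trace ℂ E (LinearMap.adjoint A ∘ₗ B) := fun _ _ => rfl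
  have hd : (finrank ℂ E : ℂ) ≠ 0 := Nat.cast_ne_zero.2 finrank_pos.ne'
  have hcard : finrank ℂ (E →ₗ[ℂ] E) = Fintype.card (Fin (finrank ℂ E ^ 2)) := by
    rw [finrank_linearMap, Fintype.card_fin, sq]
  have hid : inner ℂ (LinearMap.id : E →ₗ[ℂ] E) LinearMap.id = 1 := by
    rw [hinner, LinearMap.comp_id,
      show LinearMap.adjoint (LinearMap.id : E →ₗ[ℂ] E) = LinearMap.id from
        LinearMap.adjoint_id, LinearMap.trace_id, inv_mul_cancel₀ hd]
  have hv : Orthonormal ℂ (({α | (α : ℕ) = 0} : Set (Fin (finrank ℂ E ^ 2))).domRestrict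
      fun _ => (LinearMap.id : E →ₗ[ℂ] E)) := by
    rw [orthonormal_iff_ite]
    rintro ⟨α, hα⟩ ⟨β, hβ⟩
    have : α = β := Fin.ext (Eq.trans hα (Eq.symm hβ))
    subst this
    simpa using hid
  obtain ⟨b, hb⟩ := hv.exists_orthonormalBasis_extension_of_card_eq hcard
  refine ⟨b.toBasis, fun α hα => ?_, fun α β => ?_⟩
  · rw [b.coe_toBasis]
    exact hb α hα
  · rw [b.coe_toBasis, ← hinner]
    exact orthonormal_iff_ite.1 b.orthonormal α β

end SiteBasis

/-! ### Symmetric time evolution implies 1-locality -/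

section Symmetry

variable {n : ℕ}
  {H : Type*} [NormedAddCommGroup H] [InnerProductSpace ℂ H]
  {F : Fin n → Type*} [∀ i, NormedAddCommGroup (F i)] [∀ i, InnerProductSpace ℂ (F i)]

theorem mem_stab_mk [CompleteSpace H] (T : TensorIso H F) (U : unitary (H →L[ℂ] H)) :
    U ∈ TPS.stab (Quotient.mk _ T : TPS H F) ↔
      IsLocalPerm (T.toLinearEquiv.symm.trans (T.precomp U).toLinearEquiv) :=
  Quotient.eq (r := tensorIsoSetoid H F)

theorem toLinearEquiv_precomp [CompleteSpace H] (T : TensorIso H F) (U : unitary (H →L[ℂ] H)) :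
    ((T.toLinearEquiv.symm.trans (T.precomp U).toLinearEquiv : _ ≃ₗ[ℂ] _) :
      (⨂[ℂ] i, F i) →ₗ[ℂ] ⨂[ℂ] i, F i) =
        T.toLinearEquiv.conj ((U : H →L[ℂ] H) : H →ₗ[ℂ] H) := rfl

/-- If `W` permutes the factors, up to operators on the factors, then a power of `W` by a multiple
of the order of the permutation group is a product operator. -/
theorem exists_pow_eq_map {W : End ℂ (⨂[ℂ] i, F i)} {σ : Equiv.Perm (Fin n)}
    {V : ∀ i, F (σ.symm i) →ₗ[ℂ] F i}
    (h : ∀ x : ∀ i, F i, W (PiTensorProduct.tprod ℂ x) =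
      PiTensorProduct.tprod ℂ fun i => V i (x (σ.symm i))) :
    ∃ V' : ∀ i, F i →ₗ[ℂ] F i,
      W ^ Fintype.card (Equiv.Perm (Fin n)) = PiTensorProduct.map V' := by
  have key : ∀ m : ℕ, ∃ V' : ∀ i, F ((σ ^ m).symm i) →ₗ[ℂ] F i, ∀ x : ∀ i, F i,
      (W ^ m) (PiTensorProduct.tprod ℂ x) =
        PiTensorProduct.tprod ℂ fun i => V' i (x ((σ ^ m).symm i)) := by
    intro m
    induction m with
    | zero => exact ⟨fun i => LinearMap.id, fun x => rfl⟩
    | succ m ih =>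
      obtain ⟨V', hV'⟩ := ih
      rw [pow_succ σ, pow_succ W]
      refine ⟨fun i => V' i ∘ₗ V ((σ ^ m).symm i), fun x => ?_⟩
      rw [Module.End.mul_apply, h, hV']
      rfl
  obtain ⟨V', hV'⟩ := key (Fintype.card (Equiv.Perm (Fin n)))
  -- The types of the `V' i` depend on `σ ^ N`, so they must be generalised before it is replaced by
  -- `1`.
  revert V'
  rw [pow_card_eq_one]
  intro V' hV'
  refine ⟨V', PiTensorProduct.ext (MultilinearMap.ext fun x => ?_)⟩
  exact (hV' x).trans (PiTensorProduct.map_tprod (R := ℂ) (t := F) V' x).symm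

theorem timeEvolution_pow [CompleteSpace H] (Ĥ : selfAdjoint (H →L[ℂ] H)) (t : ℝ) (m : ℕ) :
    ((timeEvolution Ĥ t : H →L[ℂ] H)) ^ m = timeEvolution Ĥ (m * t) := by
  let _ : NormedAlgebra ℚ (H →L[ℂ] H) := NormedAlgebra.restrictScalars ℚ ℂ _
  change NormedSpace.exp _ ^ m = NormedSpace.exp _
  rw [← NormedSpace.exp_nsmul, ← Nat.cast_smul_eq_nsmul ℂ, smul_smul]
  congr 2
  push_cast
  ring

theorem conj_timeEvolution_eq_map [CompleteSpace H] {Ĥ : selfAdjoint (H →L[ℂ] H)}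
    {T : TensorIso H F}
    (h : ∀ t : ℝ, timeEvolution Ĥ t ∈ TPS.stab (Quotient.mk _ T : TPS H F)) (t : ℝ) :
    ∃ V : ∀ i, F i →ₗ[ℂ] F i,
      T.toLinearEquiv.conj ((timeEvolution Ĥ t : H →L[ℂ] H) : H →ₗ[ℂ] H) =
        PiTensorProduct.map V := by
  set N := Fintype.card (Equiv.Perm (Fin n)) with hN
  have hN0 : (N : ℝ) ≠ 0 := Nat.cast_ne_zero.2 Fintype.card_ne_zero
  obtain ⟨σ, V, hV⟩ := (mem_stab_mk T _).1 (h (t / N))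
  obtain ⟨V', hV'⟩ := exists_pow_eq_map (V := fun i => (V i).toLinearEquiv.toLinearMap)
    (W := T.toLinearEquiv.conj ((timeEvolution Ĥ (t / N) : H →L[ℂ] H) : H →ₗ[ℂ] H)) hV
  refine ⟨V', ?_⟩
  have ht : (timeEvolution Ĥ t : H →L[ℂ] H) = (timeEvolution Ĥ (t / N) : H →L[ℂ] H) ^ N := by
    rw [timeEvolution_pow, mul_div_cancel₀ t hN0]
  rw [← hV', ← hN, ht, ContinuousLinearMap.toLinearMap_pow]
  exact map_pow (T.toLinearEquiv.conjAlgEquiv ℂ) _ N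

theorem hasDerivAt_timeEvolution [CompleteSpace H] (Ĥ : selfAdjoint (H →L[ℂ] H)) :
    HasDerivAt (fun t : ℝ => (timeEvolution Ĥ t : H →L[ℂ] H))
      (-Complex.I • (Ĥ : H →L[ℂ] H)) 0 := by
  have h := hasDerivAt_exp_smul_const (𝕂 := ℝ) (-Complex.I • (Ĥ : H →L[ℂ] H)) 0
  rw [zero_smul, NormedSpace.exp_zero, one_mul] at h
  refine h.congr_of_eventuallyEq (Filter.Eventually.of_forall fun t => ?_)
  change NormedSpace.exp _ = NormedSpace.exp _
  congr 1
  rw [← Complex.coe_smul, smul_smul]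
  congr 1
  ring

theorem timeEvolution_zero [CompleteSpace H] (Ĥ : selfAdjoint (H →L[ℂ] H)) :
    (timeEvolution Ĥ 0 : H →L[ℂ] H) = 1 := by
  change NormedSpace.exp _ = _
  simp

variable [∀ i, FiniteDimensional ℂ (F i)]

/-- The adjoint of a product is the product of the adjoints: this is clear on pure tensors, which
span. The inner product on the tensor product is the one transported from `H` by `T`. -/
theorem TensorIso.inner_symm_map (T : TensorIso H F) (V : ∀ i, F i →L[ℂ] F i)
    (x y : ⨂[ℂ] i, F i) :
    inner ℂ (T.toLinearEquiv.symm (PiTensorProduct.map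
        (fun i => (ContinuousLinearMap.adjoint (V i) : F i →ₗ[ℂ] F i)) x))
      (T.toLinearEquiv.symm y) =
    inner ℂ (T.toLinearEquiv.symm x)
      (T.toLinearEquiv.symm (PiTensorProduct.map (fun i => (V i : F i →ₗ[ℂ] F i)) y)) := by
  have hx : x ∈ Submodule.span ℂ (Set.range (PiTensorProduct.tprod ℂ (s := F))) := by
    rw [span_tprod_eq_top]; trivial
  have hy : y ∈ Submodule.span ℂ (Set.range (PiTensorProduct.tprod ℂ (s := F))) := by
    rw [span_tprod_eq_top]; trivial
  induction hx using Submodule.span_induction with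
  | zero => simp
  | add x x' _ _ h h' => simp only [map_add, inner_add_left, h, h']
  | smul c x _ h => simp only [map_smul, inner_smul_left, h]
  | mem x hx =>
    obtain ⟨x, rfl⟩ := hx
    induction hy using Submodule.span_induction with
    | zero => simp
    | add y y' _ _ h h' => simp only [map_add, inner_add_right, h, h']
    | smul c y _ h => simp only [map_smul, inner_smul_right, h]
    | mem y hy =>
      obtain ⟨y, rfl⟩ := hy
      simp [T.inner_symm_tprod, ContinuousLinearMap.adjoint_inner_left]

theorem isKLocal_one_of_forall_mem_stab [CompleteSpace H] [FiniteDimensional ℂ H]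
    [∀ i, Nontrivial (F i)] {Ĥ : selfAdjoint (H →L[ℂ] H)} {𝒯 : TPS H F}
    (h : ∀ t : ℝ, timeEvolution Ĥ t ∈ 𝒯.stab) : IsKLocal 1 Ĥ 𝒯 := by
  obtain ⟨T, rfl⟩ := Quotient.exists_rep 𝒯
  choose O hO using fun i => exists_isSiteBasis (F i)
  let K := T.toLinearEquiv.conj ((Ĥ : H →L[ℂ] H) : H →ₗ[ℂ] H)
  refine ⟨T, rfl, O, hO, (productBasis O).repr K, fun α hα => ?_, ?_⟩
  swap
  · simp_rw [← productBasis_apply]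
    exact ((productBasis O).sum_repr K).symm
  obtain ⟨i, hi, j, hj, hij⟩ := Finset.one_lt_card.1 hα
  simp only [Finset.mem_filter, Finset.mem_univ, true_and] at hi hj
  have hd : ∀ i, 0 < finrank ℂ (F i) ^ 2 := fun i => pow_pos finrank_pos 2
  -- The multi-index of the identity operator.
  let o : ∀ i, Fin (finrank ℂ (F i) ^ 2) := fun i => ⟨0, hd i⟩
  -- Coefficients as continuous real-linear functionals, so that they can be differentiated along
  -- real `t`.
  let coeff : (∀ i, Fin (finrank ℂ (F i) ^ 2)) → (H →L[ℂ] H) →L[ℝ] ℂ := fun β =>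
    (LinearMap.toContinuousLinearMap ((productBasis O).coord β ∘ₗ
      T.toLinearEquiv.conj.toLinearMap ∘ₗ ContinuousLinearMap.coeLM ℂ)).restrictScalars ℝ
  have coeff_apply : ∀ β (X : H →L[ℂ] H), coeff β X =
      (productBasis O).repr (T.toLinearEquiv.conj (X : H →ₗ[ℂ] H)) β := fun _ _ => rfl
  have hone : PiTensorProduct.map (fun i => O i (o i)) =
      T.toLinearEquiv.conj ((1 : H →L[ℂ] H) : H →ₗ[ℂ] H) := by
    have e : (fun i => O i (o i)) = fun i => LinearMap.id := funext fun i => (hO i).zero _ rfl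
    rw [e, PiTensorProduct.map_id]
    exact (map_one (T.toLinearEquiv.conjAlgEquiv ℂ)).symm
  have coeff_one : ∀ β, coeff β 1 = if o = β then 1 else 0 := fun β => by
    rw [coeff_apply, ← hone, ← productBasis_apply, Basis.repr_self, Finsupp.single_apply]
  have hderiv : ∀ β, HasDerivAt (fun t : ℝ => coeff β (timeEvolution Ĥ t))
      (coeff β (-Complex.I • (Ĥ : H →L[ℂ] H))) 0 := fun β =>
    (coeff β).hasFDerivAt.comp_hasDerivAt (0 : ℝ) (hasDerivAt_timeEvolution Ĥ)
  have hsegre : (fun t : ℝ => coeff α (timeEvolution Ĥ t) * coeff o (timeEvolution Ĥ t)) =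
      fun t : ℝ => coeff (Function.update α i (o i)) (timeEvolution Ĥ t) *
        coeff (Function.update o i (α i)) (timeEvolution Ĥ t) := by
    funext t
    obtain ⟨V, hV⟩ := conj_timeEvolution_eq_map h t
    simp only [coeff_apply, hV]
    exact productBasis_repr_map_mul O V α o i
  have ne_o : ∀ (β : ∀ i, Fin (finrank ℂ (F i) ^ 2)) k, (β k : ℕ) ≠ 0 → o ≠ β := by
    rintro _ k hk rfl
    exact hk rfl
  have hval := ((hderiv α).mul (hderiv o)).unique
    (((hderiv (Function.update α i (o i))).mul
      (hderiv (Function.update o i (α i)))).congr_of_eventuallyEq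
      (Filter.Eventually.of_forall (congrFun hsegre)))
  -- At `t = 0` only the coefficient at `o` survives: `α` and the updated `o` are nonzero at `i`,
  -- and the updated `α` is still nonzero at `j`. The product rule leaves just the derivative of the
  -- coefficient at `α`.
  rw [timeEvolution_zero, coeff_one o, coeff_one α, coeff_one (Function.update α i (o i)),
    coeff_one (Function.update o i (α i)), if_pos rfl,
    if_neg (ne_o α i hi), if_neg (ne_o (Function.update α i (o i)) j (by simpa [hij.symm] using hj)),
    if_neg (ne_o (Function.update o i (α i)) i (by simpa using hi))] at hval
  simpa [coeff_apply] using hval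

end Symmetry

/-! ### 1-locality implies symmetric time evolution -/

section Locality

variable {n : ℕ}
  {H : Type*} [NormedAddCommGroup H] [InnerProductSpace ℂ H] [FiniteDimensional ℂ H]
  {F : Fin n → Type*} [∀ i, NormedAddCommGroup (F i)] [∀ i, InnerProductSpace ℂ (F i)]

/-- The operator on `H` corresponding under `T` to a product of operators on the factors. -/
def TensorIso.productHom (T : TensorIso H F) : (∀ i, F i →L[ℂ] F i) →* (H →L[ℂ] H) where
  toFun V := LinearMap.toContinuousLinearMap
    (T.toLinearEquiv.symm.conj (PiTensorProduct.map fun i => (V i : F i →ₗ[ℂ] F i)))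
  map_one' := by
    ext x
    have e : PiTensorProduct.map
        (fun i => (((1 : ∀ i, F i →L[ℂ] F i) i : F i →L[ℂ] F i) : F i →ₗ[ℂ] F i)) = LinearMap.id :=
      PiTensorProduct.map_id
    rw [e]
    simp
  map_mul' V W := by
    ext x
    have e : PiTensorProduct.map (fun i => ((V * W) i : F i →ₗ[ℂ] F i)) =
        PiTensorProduct.map (fun i => (V i : F i →ₗ[ℂ] F i)) ∘ₗ
          PiTensorProduct.map (fun i => (W i : F i →ₗ[ℂ] F i)) :=
      PiTensorProduct.map_comp _ _
    rw [e]
    simp [LinearEquiv.conj_apply]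

theorem TensorIso.conj_productHom (T : TensorIso H F) (V : ∀ i, F i →L[ℂ] F i) :
    T.toLinearEquiv.conj (T.productHom V : H →ₗ[ℂ] H) =
      PiTensorProduct.map fun i => (V i : F i →ₗ[ℂ] F i) := by
  ext x
  simp [productHom, LinearEquiv.conj_apply]

variable [∀ i, FiniteDimensional ℂ (F i)]

/-- The operator on `H` corresponding under `T` to an operator on the factor `i`. -/
def TensorIso.siteHom (T : TensorIso H F) (i : Fin n) : (F i →L[ℂ] F i) →ₐ[ℂ] (H →L[ℂ] H) :=
  (Module.End.toContinuousLinearMap H).toAlgHom.comp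
    ((T.toLinearEquiv.symm.conjAlgEquiv ℂ).toAlgHom.comp
      ((singleSite i).comp (Module.End.toContinuousLinearMap (F i)).symm.toAlgHom))

theorem TensorIso.conj_siteHom (T : TensorIso H F) (i : Fin n) (A : F i →L[ℂ] F i) :
    T.toLinearEquiv.conj (T.siteHom i A : H →ₗ[ℂ] H) = singleSite i (A : F i →ₗ[ℂ] F i) := by
  refine LinearMap.ext fun x => ?_
  change T.toLinearEquiv (T.toLinearEquiv.symm (singleSite i _ (T.toLinearEquiv
    (T.toLinearEquiv.symm x)))) = _
  rw [LinearEquiv.apply_symm_apply, LinearEquiv.apply_symm_apply]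
  rfl

/-- Reduces commutation and adjoints of single-site operators to those of `Pi.mulSingle`. -/
theorem TensorIso.siteHom_eq_productHom (T : TensorIso H F) (i : Fin n) (A : F i →L[ℂ] F i) :
    T.siteHom i A = T.productHom (Pi.mulSingle i A) := by
  have h : T.toLinearEquiv.conj (T.siteHom i A : H →ₗ[ℂ] H) =
      T.toLinearEquiv.conj (T.productHom (Pi.mulSingle i A) : H →ₗ[ℂ] H) := by
    rw [conj_siteHom, conj_productHom, singleSite_apply]
    congr 1
    funext j
    rcases eq_or_ne j i with rfl | hj
    · simp
    · simp [hj]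
  exact ContinuousLinearMap.coe_injective (T.toLinearEquiv.conj.injective h)

variable [CompleteSpace H]

theorem TensorIso.star_productHom (T : TensorIso H F) (V : ∀ i, F i →L[ℂ] F i) :
    star (T.productHom V) = T.productHom (star V) := by
  refine Eq.symm ((ContinuousLinearMap.eq_adjoint_iff _ _).2 fun x y => ?_)
  have := T.inner_symm_map V (T.toLinearEquiv x) (T.toLinearEquiv y)
  rwa [LinearEquiv.symm_apply_apply, LinearEquiv.symm_apply_apply] at this

theorem TensorIso.star_siteHom (T : TensorIso H F) (i : Fin n) (A : F i →L[ℂ] F i) :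
    star (T.siteHom i A) = T.siteHom i (star A) := by
  rw [siteHom_eq_productHom, siteHom_eq_productHom, star_productHom]
  congr 1
  funext j
  rcases eq_or_ne j i with rfl | hj
  · simp
  · simp [hj]

/-- A Hermitian sum of single-site operators is a sum of Hermitian single-site operators. -/
theorem TensorIso.exists_selfAdjoint_sum_siteHom (T : TensorIso H F)
    (Ĥ : selfAdjoint (H →L[ℂ] H)) {A : ∀ i, F i →L[ℂ] F i}
    (h : (Ĥ : H →L[ℂ] H) = ∑ i, T.siteHom i (A i)) :
    ∃ B : ∀ i, selfAdjoint (F i →L[ℂ] F i), (Ĥ : H →L[ℂ] H) = ∑ i, T.siteHom i (B i) := by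
  have h' : (Ĥ : H →L[ℂ] H) = ∑ i, T.siteHom i (star (A i)) := by
    rw [← Ĥ.2.star_eq, h, star_sum]
    simp_rw [star_siteHom]
  refine ⟨fun i => ⟨(2⁻¹ : ℂ) • (A i + star (A i)), ?_⟩, ?_⟩
  · rw [selfAdjoint.mem_iff, star_smul, star_add, star_star, add_comm (star (A i))]
    simp
  · simp only [map_smul, map_add, ← Finset.smul_sum, Finset.sum_add_distrib, ← h, ← h']
    rw [← two_smul ℂ, smul_smul]
    simp

/-- Summands on different sites commute, so the exponential of the sum is a product; each factor
stays on its site because `siteHom` is a continuous algebra homomorphism. -/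
theorem exp_sum_siteHom (T : TensorIso H F) (A : ∀ i, F i →L[ℂ] F i) :
    NormedSpace.exp (∑ i, T.siteHom i (A i)) = T.productHom fun i => NormedSpace.exp (A i) := by
  let _ : NormedAlgebra ℚ (H →L[ℂ] H) := NormedAlgebra.restrictScalars ℚ ℂ _
  let _ := fun i => (NormedAlgebra.restrictScalars ℚ ℂ (F i →L[ℂ] F i))
  have hcomm : ((Finset.univ : Finset (Fin n)) : Set (Fin n)).Pairwise
      (Function.onFun Commute fun i => T.siteHom i (A i)) := by
    intro i _ j _ hij
    simp only [Function.onFun, TensorIso.siteHom_eq_productHom]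
    exact (Pi.mulSingle_commute hij _ _).map _
  have hexp : ∀ i, NormedSpace.exp (T.siteHom i (A i)) =
      T.productHom (Pi.mulSingle i (NormedSpace.exp (A i))) := fun i => by
    rw [← TensorIso.siteHom_eq_productHom]
    exact (NormedSpace.map_exp (T.siteHom i)
      (LinearMap.continuous_of_finiteDimensional (T.siteHom i).toLinearMap) _).symm
  rw [NormedSpace.exp_sum_of_commute _ _ hcomm]
  simp only [hexp]
  rw [← Finset.map_noncommProd _ _ (fun i _ j _ hij => Pi.mulSingle_commute hij _ _),
    Finset.noncommProd_mulSingle]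

/-- A `1`-local operator is a sum of single-site operators. -/
theorem IsKLocal.exists_sum_siteHom (hn : 0 < n) {Ĥ : selfAdjoint (H →L[ℂ] H)} {𝒯 : TPS H F}
    (h : IsKLocal 1 Ĥ 𝒯) :
    ∃ T : TensorIso H F, (Quotient.mk _ T : TPS H F) = 𝒯 ∧
      ∃ A : ∀ i, F i →L[ℂ] F i, (Ĥ : H →L[ℂ] H) = ∑ i, T.siteHom i (A i) := by
  obtain ⟨T, hT, O, hO, a, ha, hsum⟩ := h
  refine ⟨T, hT, ?_⟩
  let S : (∀ i, F i →L[ℂ] F i) →ₗ[ℂ] End ℂ (⨂[ℂ] i, F i) :=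
    ∑ i, (singleSite i).toLinearMap ∘ₗ ContinuousLinearMap.coeLM ℂ ∘ₗ LinearMap.proj i
  have hS : ∀ A, S A = ∑ i, singleSite i (A i : F i →ₗ[ℂ] F i) := fun A => by
    simp [S]
  have hmem : T.toLinearEquiv.conj ((Ĥ : H →L[ℂ] H) : H →ₗ[ℂ] H) ∈ LinearMap.range S := by
    rw [hsum]
    refine Submodule.sum_mem _ fun α _ => ?_
    by_cases hα : 1 < (Finset.univ.filter fun i => (α i : ℕ) ≠ 0).card
    · rw [ha α hα, zero_smul]
      exact Submodule.zero_mem _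
    refine Submodule.smul_mem _ _ ?_
    -- If all `α j` vanish, some site must still carry the scalar term.
    have : Nonempty (Fin n) := ⟨⟨0, hn⟩⟩
    obtain ⟨i, hi⟩ : ∃ i, ∀ j ≠ i, (α j : ℕ) = 0 := by
      rcases Finset.card_le_one_iff_subset_singleton (α := Fin n) |>.1 (not_lt.1 hα) with ⟨i, hi⟩
      refine ⟨i, fun j hj => ?_⟩
      by_contra hj0
      exact hj (Finset.mem_singleton.1 (hi (Finset.mem_filter.2 ⟨Finset.mem_univ j, hj0⟩)))
    refine ⟨Pi.single i (LinearMap.toContinuousLinearMap (O i (α i))), ?_⟩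
    rw [hS, Finset.sum_eq_single i (fun j _ hj => by simp [Pi.single_eq_of_ne hj]) (by simp),
      Pi.single_eq_same, singleSite_apply]
    congr 1
    funext j
    rcases eq_or_ne j i with rfl | hj
    · simp
    · rw [Pi.mulSingle_eq_of_ne hj, (hO j).zero _ (hi j hj)]
      rfl
  obtain ⟨A, hA⟩ := hmem
  refine ⟨A, ContinuousLinearMap.coe_injective (T.toLinearEquiv.conj.injective ?_)⟩
  rw [← hA, hS, ContinuousLinearMap.toLinearMap_sum, map_sum]
  simp_rw [TensorIso.conj_siteHom]

theorem forall_mem_stab_of_isKLocal_one (hn : 0 < n) {Ĥ : selfAdjoint (H →L[ℂ] H)} {𝒯 : TPS H F}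
    (h : IsKLocal 1 Ĥ 𝒯) (t : ℝ) : timeEvolution Ĥ t ∈ 𝒯.stab := by
  obtain ⟨T, rfl, A, hA⟩ := h.exists_sum_siteHom hn
  obtain ⟨B, hB⟩ := T.exists_selfAdjoint_sum_siteHom Ĥ hA
  have hexp : (timeEvolution Ĥ t : H →L[ℂ] H) = T.productHom fun i => timeEvolution (B i) t := by
    refine Eq.trans ?_ (exp_sum_siteHom T _)
    simp only [map_smul, ← Finset.smul_sum, ← hB]
    rfl
  -- No permutation is needed; the local factors are unitary because the `B i` are Hermitian.
  refine (mem_stab_mk T _).2 ⟨1, fun i => Unitary.linearIsometryEquiv (timeEvolution (B i) t),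
    fun x => ?_⟩
  refine (LinearMap.congr_fun (toLinearEquiv_precomp T _) _).trans ?_
  rw [hexp, T.conj_productHom]
  exact PiTensorProduct.map_tprod _ x

end Locality

end TPSLocality

end

theorem proposition2p4 {n : ℕ} (hn : 2 ≤ n) (d : Fin n → ℕ) (hd : ∀ i, 2 ≤ d i)
    {H : Type*} [NormedAddCommGroup H] [InnerProductSpace ℂ H] [CompleteSpace H]
    (hH : Module.finrank ℂ H = ∏ i, d i)
    {F : Fin n → Type*} [∀ i, NormedAddCommGroup (F i)] [∀ i, InnerProductSpace ℂ (F i)]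
    [∀ i, FiniteDimensional ℂ (F i)] (hF : ∀ i, Module.finrank ℂ (F i) = d i)
    (Ĥ : selfAdjoint (H →L[ℂ] H)) (𝒯 : TPSLocality.TPS H F) :
    (∀ t : ℝ, TPSLocality.timeEvolution Ĥ t ∈ 𝒯.stab) ↔ TPSLocality.IsKLocal 1 Ĥ 𝒯 := by
  have hpos : ∀ i, 0 < d i := fun i => two_pos.trans_le (hd i)
  -- `finrank` is `0` in infinite dimension, so a positive value forces finiteness.
  have : FiniteDimensional ℂ H := Module.finite_of_finrank_pos (by
    rw [hH]
    exact Finset.prod_pos fun i _ => hpos i)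
  have : ∀ i, Nontrivial (F i) := fun i => Module.nontrivial_of_finrank_pos (R := ℂ) (by
    rw [hF]
    exact hpos i)
  exact ⟨TPSLocality.isKLocal_one_of_forall_mem_stab,
    TPSLocality.forall_mem_stab_of_isKLocal_one (two_pos.trans_le hn)⟩
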